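/- Let $N \ge 2$ be an integer. For $0<\alpha<\beta$, $h\in\mathbb{R}\cup\{+\infty\}$ and an integer $l\ge 0$, consider the Sturm–Liouville eigenvalue problem $$-v''-\frac{N-1}{r}v'+\frac{l(l+N-2)}{r^2}v=\tau v \quad\text{in } (\alpha,\beta),\qquad -v'(\alpha)+h\,v(\alpha)=0,\quad v'(\beta)=0,$$ where for $h=+\infty$ the condition at $\alpha$ is understood as $v(\alpha)=0$. Let $\tau_{l,1}<\tau_{l,2}<\cdots$ denote its eigenvalues in increasing order (they depend on $N,\alpha,\beta,h$). Lemma. Let $\beta>0$ and let $l\ge 1$ be an integer. Then for every $\alpha\in(0,\beta)$ there exists $\bar h_l^*=\bar h_l^*(\alpha)\in\mathbb{R}\cup\{+\infty\}$ such that for every $h\in(-\infty,\bar h_l^*]$ $$\tau_{0,1}<\tau_{1,1}<\cdots<\tau_{l,1}<\tau_{0,2}. \qquad (*)$$ Moreover, these $\bar h_l^*$ can be chosen so that there exists $\alpha_l^*\in(0,\beta)$, depending only on $N,\beta,l$, with $\bar h_l^*(\alpha)=+\infty$ for every $\alpha\in[\alpha_l^*,\beta)$. Furthermore, in the case $l=2$,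 for every $\alpha\in(0,\beta)$ there also exists $h_2^*<0$ such that $(*)$, i.e. $\tau_{0,1}<\tau_{1,1}<\tau_{2,1}<\tau_{0,2}$, holds for every $h\in(-\infty,\bar h_2^*]\cup[h_2^*,+\infty]$. -/

import Mathlib

open Set

/-- `v` is a classical solution on `[α, β]`, not identically zero there, of
`-v'' - (N-1)/r * v' + l(l+N-2)/r² * v = t * v` with `-v'(α) + h v(α) = 0` and `v'(β) = 0`.
For `h = +∞` (that is, `h = ⊤`) the condition at `α` is `v(α) = 0`.
The function `w` is the derivative of `v` on `[α, β]` (one-sided at the end points). -/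
def IsEigenpair (N : ℕ) (α β : ℝ) (h : WithTop ℝ) (l : ℕ) (t : ℝ) (v w : ℝ → ℝ) : Prop :=
  (∀ r ∈ Icc α β, HasDerivWithinAt v (w r) (Icc α β) r) ∧
  (∀ r ∈ Icc α β, HasDerivWithinAt w
    (-(((N : ℝ) - 1) / r) * w r + ((l : ℝ) * ((l : ℝ) + (N : ℝ) - 2) / r ^ 2) * v r - t * v r)
    (Icc α β) r) ∧
  (∀ c : ℝ, h = (c : WithTop ℝ) → -w α + c * v α = 0) ∧
  (h = ⊤ → v α = 0) ∧
  w β = 0 ∧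
  ∃ r ∈ Icc α β, v r ≠ 0

/-- The set of eigenvalues of the radial Sturm-Liouville problem with angular index `l`. -/
def radialSpectrum (N : ℕ) (α β : ℝ) (h : WithTop ℝ) (l : ℕ) : Set ℝ :=
  {t | ∃ v w : ℝ → ℝ, IsEigenpair N α β h l t v w}

/-- `t` is an eigenvalue and exactly `j` eigenvalues are at most `t`, that is, `t` is the `j`-th
eigenvalue in increasing order, counted from `j = 1`. -/
def IsNthEigenvalue (N : ℕ) (α β : ℝ) (h : WithTop ℝ) (l j : ℕ) (t : ℝ) : Prop :=
  t ∈ radialSpectrum N α β h l ∧ (radialSpectrum N α β h l ∩ Iic t).encard = j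

/-- The eigenvalue `τ_{l,j}`, `j ≥ 1`: the least eigenvalue `t` such that at least `j` eigenvalues
are at most `t`. -/
noncomputable def tau (N : ℕ) (α β : ℝ) (h : WithTop ℝ) (l j : ℕ) : ℝ :=
  sInf {t | t ∈ radialSpectrum N α β h l ∧
    (j : ℕ∞) ≤ (radialSpectrum N α β h l ∩ Iic t).encard}

/-- If a `j`-th eigenvalue exists, it is unique and it is `tau`. -/
theorem IsNthEigenvalue.tau_eq {N : ℕ} {α β : ℝ} {h : WithTop ℝ} {l j : ℕ} {t : ℝ}
    (ht : IsNthEigenvalue N α β h l j t) : tau N α β h l j = t := by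
  refine IsLeast.csInf_eq ⟨⟨ht.1, ht.2.ge⟩, ?_⟩
  rintro s ⟨hs, hjs⟩
  by_contra! hlt
  have hfin : (radialSpectrum N α β h l ∩ Iic s).Finite :=
    (Set.finite_of_encard_eq_coe ht.2).subset
      (inter_subset_inter_right _ (Iic_subset_Iic.2 hlt.le))
  have hss : radialSpectrum N α β h l ∩ Iic s ⊂ radialSpectrum N α β h l ∩ Iic t :=
    (ssubset_iff_of_subset (inter_subset_inter_right _ (Iic_subset_Iic.2 hlt.le))).2
      ⟨t, ⟨ht.1, le_refl t⟩, fun hm => absurd hm.2 (not_le.2 hlt)⟩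
  have := hfin.encard_lt_encard hss
  rw [ht.2] at this
  exact absurd hjs (not_le.2 this)

/-- The chain `τ_{0,1} < τ_{1,1} < … < τ_{l,1} < τ_{0,2}`. The first two clauses say that the
numbers in the chain are genuine eigenvalues of the stated order (not default values of `sInf`). -/
def EigenvalueChain (N : ℕ) (α β : ℝ) (h : WithTop ℝ) (l : ℕ) : Prop :=
  (∀ k ≤ l, IsNthEigenvalue N α β h k 1 (tau N α β h k 1)) ∧
  IsNthEigenvalue N α β h 0 2 (tau N α β h 0 2) ∧
  (∀ k < l, tau N α β h k 1 < tau N α β h (k + 1) 1) ∧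
  tau N α β h l 1 < tau N α β h 0 2

/-! Write a solution with `v'(β) = 0` in Prüfer form `v = ρ cos θ`, `v' = ρ sin θ`, normalised by
`θ(β) = 0`, and follow the phase backwards to `α`. With `η ∈ (-π/2, π/2]` the angle of the condition
at `α`, the eigenvalues are the `t` for which `endPhase` equals `η + nπ` with `n ≥ 0`
(`mem_radialSpectrum_iff`). The end phase is continuous and strictly increasing in `t`, stays above
`-π/2`, takes every value in `(-π/2, 3π/2]`, and strictly decreases when the angular coefficient
grows. So the first eigenvalues increase with the angular index, and only `τ_{l,1} < τ_{0,2}` needs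
work: when the radial phase has reached `η + π`, the degree `l` phase must have passed `η`
(`eigenvalueChain_of_phase`).

This is obtained in three ways. For `h` near `-∞`, `η` is near `-π/2`, while `t` stays above the
fixed number where the radial phase is `π/2`; there the degree `l` phase is a fixed number above
`-π/2`. On a thin annulus the curvature and angular terms are small perturbations, both phases are
close to that of `cos (√t (β - r))`, and a gap of `π` cannot be lost, whatever `h` is.

For `l = 2`, take the second radial Neumann eigenfunction `v`. The radial factor `ψ = v'' - v'/r` of
its trace-free Hessian solves the degree 2 equation. Where `v' = 0` one has `ψ = -t v`, so `ψ` has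
opposite signs at the two ends. Sturm comparison then puts the first degree 2 eigenvalue with
Dirichlet condition at `α` strictly below the second radial Neumann one
(`pi_div_two_lt_endPhase_of_eq_pi`). Strictness leaves room for slightly negative `h`. -/

namespace RadialPhase

open Real

/-! ### The Prüfer vector field and its bounds -/

/-- The right-hand side of the Prüfer equation for the phase `x` of `(v, v')`, where
`v'' = -(m / r) v' + (c / r ^ 2 - t) v`, `v = ρ cos x` and `v' = ρ sin x`. -/
noncomputable def slope (m c t r x : ℝ) : ℝ :=
  (c / r ^ 2 - t) * cos x ^ 2 - m / r * (sin x * cos x) - sin x ^ 2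

/-- The difference quotient of `slope` between two phases. -/
noncomputable def slopeQuot (m c t r x y : ℝ) : ℝ :=
  sinc (x - y) * (-(c / r ^ 2 - t) * sin (x + y) - m / r * cos (x + y) - sin (x + y))

theorem sinc_mul_self (x : ℝ) : sinc x * x = sin x := by
  by_cases h : x = 0
  · simp [h]
  · rw [sinc_of_ne_zero h]; field_simp

/-- Using `sinc` keeps the quotient continuous where two phases meet, so the difference of two
phases obeys a linear equation with continuous coefficient. -/
theorem slope_sub (m c t r x y : ℝ) :
    slope m c t r x - slope m c t r y = slopeQuot m c t r x y * (x - y) := by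
  have h : slopeQuot m c t r x y * (x - y) = sin (x - y) *
      (-(c / r ^ 2 - t) * sin (x + y) - m / r * cos (x + y) - sin (x + y)) := by
    rw [← sinc_mul_self, slopeQuot]; ring
  rw [h, slope, slope, sin_sub, sin_add, cos_add]
  have hx := sin_sq_add_cos_sq x
  have hy := sin_sq_add_cos_sq y
  have ex : sin x ^ 2 = 1 - cos x ^ 2 := by linarith
  have ey : sin y ^ 2 = 1 - cos y ^ 2 := by linarith
  have e1 : sin x ^ 2 * cos y ^ 2 - cos x ^ 2 * sin y ^ 2 = cos y ^ 2 - cos x ^ 2 := by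
    rw [ex, ey]; ring
  have e2 : (sin x * cos y - cos x * sin y) * (cos x * cos y - sin x * sin y)
      = sin x * cos x - sin y * cos y := by
    have : (sin x * cos y - cos x * sin y) * (cos x * cos y - sin x * sin y)
      = sin x * cos x * (sin y ^ 2 + cos y ^ 2) - sin y * cos y * (sin x ^ 2 + cos x ^ 2) := by ring
    rw [this, hx, hy]; ring
  have e3 : (sin x * cos y - cos x * sin y) * (sin x * cos y + cos x * sin y)
      = cos y ^ 2 - cos x ^ 2 := by rw [← e1]; ring
  linear_combination (c / r ^ 2 - t + 1) * e3 + m / r * e2 + ey - ex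

theorem abs_slopeQuot_le {m c t r a : ℝ} (hm : 0 ≤ m) (hc : 0 ≤ c) (ha : 0 < a) (hr : a ≤ r)
    (x y : ℝ) : |slopeQuot m c t r x y| ≤ c / a ^ 2 + |t| + m / a + 1 := by
  have h1 : c / r ^ 2 ≤ c / a ^ 2 := by gcongr
  have h2 : m / r ≤ m / a := by gcongr
  have h3 : 0 ≤ c / r ^ 2 := by positivity
  have h4 : 0 ≤ m / r := div_nonneg hm (ha.le.trans hr)
  rw [slopeQuot, abs_mul]
  refine (mul_le_of_le_one_left (abs_nonneg _) (abs_sinc_le_one _)).trans ?_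
  have b1 : |-(c / r ^ 2 - t) * sin (x + y)| ≤ c / r ^ 2 + |t| := by
    rw [abs_mul, abs_neg]
    refine (mul_le_of_le_one_right (abs_nonneg _) (abs_sin_le_one _)).trans ?_
    refine (abs_sub _ _).trans ?_
    rw [abs_of_nonneg h3]
  have b2 : |m / r * cos (x + y)| ≤ m / r := by
    rw [abs_mul, abs_of_nonneg h4]
    exact mul_le_of_le_one_right h4 (abs_cos_le_one _)
  have b3 := abs_sin_le_one (x + y)
  rw [abs_le] at *
  constructor <;> linarith [b1.1, b1.2, b2.1, b2.2, b3.1, b3.2]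

theorem abs_slope_le {m c t r a : ℝ} (hm : 0 ≤ m) (hc : 0 ≤ c) (ha : 0 < a) (hr : a ≤ r)
    (x : ℝ) : |slope m c t r x| ≤ c / a ^ 2 + |t| + m / a + 1 := by
  have h1 : c / r ^ 2 ≤ c / a ^ 2 := by gcongr
  have h2 : m / r ≤ m / a := by gcongr
  have h3 : 0 ≤ c / r ^ 2 := by positivity
  have h4 : 0 ≤ m / r := div_nonneg hm (ha.le.trans hr)
  have b1 : |(c / r ^ 2 - t) * cos x ^ 2| ≤ c / r ^ 2 + |t| := by
    rw [abs_mul, abs_of_nonneg (sq_nonneg (cos x))]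
    refine (mul_le_of_le_one_right (abs_nonneg _) (cos_sq_le_one _)).trans ?_
    refine (abs_sub _ _).trans ?_
    rw [abs_of_nonneg h3]
  have b2 : |m / r * (sin x * cos x)| ≤ m / r := by
    rw [abs_mul, abs_of_nonneg h4, abs_mul]
    exact mul_le_of_le_one_right h4
      (mul_le_one₀ (abs_sin_le_one _) (abs_nonneg _) (abs_cos_le_one _))
  have b3 := sin_sq_le_one x
  have b4 := sq_nonneg (sin x)
  rw [slope]
  rw [abs_le] at *
  constructor <;> linarith [b1.1, b1.2, b2.1, b2.2]

/-! ### Linear differential inequalities and comparison of phases -/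

/-- Integrating factors for first order linear equations on an interval. -/
theorem exists_integrating_factor {a b : ℝ} (hab : a ≤ b) {κ : ℝ → ℝ}
    (hκ : ContinuousOn κ (Icc a b)) :
    ∃ E : ℝ → ℝ, (∀ r, 0 < E r) ∧
      ∀ r ∈ Icc a b, HasDerivWithinAt E (-κ r * E r) (Icc a b) r := by
  set k : ℝ → ℝ := IccExtend hab ((Icc a b).domRestrict κ) with hk
  have hkc : Continuous k := (continuousOn_iff_continuous_domRestrict.1 hκ).Icc_extend'
  refine ⟨fun r => exp (-∫ x in a..r, k x), fun r => exp_pos _, fun r hr => ?_⟩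
  have h1 : HasDerivAt (fun r => ∫ x in a..r, k x) (k r) r :=
    (hkc.integral_hasStrictDerivAt a r).hasDerivAt
  have h2 : k r = κ r := by rw [hk, IccExtend_of_mem _ _ hr]; rfl
  rw [h2] at h1
  refine (h1.neg.exp.congr_deriv ?_).hasDerivWithinAt
  simp only [Pi.neg_apply]
  ring

theorem exists_antitoneOn_mul {a b : ℝ} (hab : a ≤ b) {κ D D' : ℝ → ℝ}
    (hκ : ContinuousOn κ (Icc a b))
    (hD : ∀ r ∈ Icc a b, HasDerivWithinAt D (D' r) (Icc a b) r)
    (hle : ∀ r ∈ Icc a b, D' r ≤ κ r * D r) :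
    ∃ E : ℝ → ℝ, (∀ r, 0 < E r) ∧ AntitoneOn (fun r => D r * E r) (Icc a b) := by
  obtain ⟨E, hE, hE'⟩ := exists_integrating_factor hab hκ
  refine ⟨E, hE, ?_⟩
  have hd : ∀ r ∈ Icc a b, HasDerivWithinAt (fun r => D r * E r)
      (D' r * E r + D r * (-κ r * E r)) (Icc a b) r := fun r hr => (hD r hr).mul (hE' r hr)
  refine antitoneOn_of_hasDerivWithinAt_nonpos (convex_Icc a b)
    (fun r hr => (hd r hr).continuousWithinAt)
    (fun r hr => (hd r (interior_subset hr)).mono interior_subset) fun r hr => ?_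
  have := mul_le_mul_of_nonneg_right (hle r (interior_subset hr)) (hE r).le
  linarith

theorem eq_zero_of_linear {a b : ℝ} {κ D : ℝ → ℝ}
    (hκ : ContinuousOn κ (Icc a b))
    (hD : ∀ r ∈ Icc a b, HasDerivWithinAt D (κ r * D r) (Icc a b) r)
    {r₀ : ℝ} (hr₀ : r₀ ∈ Icc a b) (h0 : D r₀ = 0) : ∀ r ∈ Icc a b, D r = 0 := by
  have hab : a ≤ b := hr₀.1.trans hr₀.2
  obtain ⟨E, hE, hE'⟩ := exists_integrating_factor hab hκ
  have hd : ∀ r ∈ Icc a b, HasDerivWithinAt (fun r => D r * E r) 0 (Icc a b) r := fun r hr =>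
    ((hD r hr).mul (hE' r hr)).congr_deriv (by ring)
  intro r hr
  rcases hab.eq_or_lt with h | h
  · subst h
    rw [Icc_self, mem_singleton_iff] at hr hr₀
    rw [hr, ← hr₀, h0]
  have := (convex_Icc a b).is_const_of_fderivWithin_eq_zero (𝕜 := ℝ)
    (f := fun r => D r * E r) (fun r hr => (hd r hr).differentiableWithinAt)
    (fun r hr => by
      rw [(hd r hr).hasFDerivWithinAt.fderivWithin (uniqueDiffOn_Icc h r hr)]; ext; simp)
    hr hr₀
  simp only [h0, zero_mul] at this
  exact (mul_eq_zero.1 this).resolve_right (hE r).ne'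

theorem continuousOn_slopeQuot {m c t a b : ℝ} (ha : 0 < a) {θ₁ θ₂ : ℝ → ℝ}
    (h₁ : ContinuousOn θ₁ (Icc a b)) (h₂ : ContinuousOn θ₂ (Icc a b)) :
    ContinuousOn (fun r => slopeQuot m c t r (θ₁ r) (θ₂ r)) (Icc a b) := by
  have hr : ∀ r ∈ Icc a b, r ≠ 0 := fun r hr => (ha.trans_le hr.1).ne'
  have hr2 : ∀ r ∈ Icc a b, r ^ 2 ≠ 0 := fun r hx => pow_ne_zero 2 (hr r hx)
  unfold slopeQuot
  have := continuous_sinc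
  refine (this.comp_continuousOn (h₁.sub h₂)).mul ?_
  have hs := continuous_sin.comp_continuousOn (h₁.add h₂)
  have hc := continuous_cos.comp_continuousOn (h₁.add h₂)
  exact (((((continuousOn_const.div (continuousOn_id.pow 2) hr2).sub continuousOn_const).neg).mul
    hs).sub ((continuousOn_const.div continuousOn_id hr).mul hc)).sub hs

/-- Comparison of a supersolution `θ₁` and a subsolution `θ₂` of the phase equation, in backward
direction. -/
theorem exists_antitoneOn_sub {m c t a b : ℝ} (ha : 0 < a) (hab : a ≤ b) {θ₁ θ₂ d₁ d₂ : ℝ → ℝ}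
    (h₁ : ∀ r ∈ Icc a b, HasDerivWithinAt θ₁ (d₁ r) (Icc a b) r)
    (h₂ : ∀ r ∈ Icc a b, HasDerivWithinAt θ₂ (d₂ r) (Icc a b) r)
    (hle : ∀ r ∈ Icc a b, d₁ r - slope m c t r (θ₁ r) ≤ d₂ r - slope m c t r (θ₂ r)) :
    ∃ E : ℝ → ℝ, (∀ r, 0 < E r) ∧ AntitoneOn (fun r => (θ₁ r - θ₂ r) * E r) (Icc a b) :=
  exists_antitoneOn_mul hab
    (continuousOn_slopeQuot (m := m) (c := c) (t := t) ha
      (fun r hr => (h₁ r hr).continuousWithinAt) (fun r hr => (h₂ r hr).continuousWithinAt))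
    (fun r hr => (h₁ r hr).sub (h₂ r hr)) fun r hr => by
      rw [← slope_sub]; linarith [hle r hr]

theorem le_of_slope_le {m c t a b : ℝ} (ha : 0 < a) (hab : a ≤ b) {θ₁ θ₂ d₁ d₂ : ℝ → ℝ}
    (h₁ : ∀ r ∈ Icc a b, HasDerivWithinAt θ₁ (d₁ r) (Icc a b) r)
    (h₂ : ∀ r ∈ Icc a b, HasDerivWithinAt θ₂ (d₂ r) (Icc a b) r)
    (hle : ∀ r ∈ Icc a b, d₁ r - slope m c t r (θ₁ r) ≤ d₂ r - slope m c t r (θ₂ r))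
    (hb : θ₂ b ≤ θ₁ b) : ∀ r ∈ Icc a b, θ₂ r ≤ θ₁ r := by
  obtain ⟨E, hE, hA⟩ := exists_antitoneOn_sub ha hab h₁ h₂ hle
  intro r hr
  have h1 := hA hr (right_mem_Icc.2 hab) hr.2
  have h2 : 0 ≤ (θ₁ b - θ₂ b) * E b := mul_nonneg (sub_nonneg.2 hb) (hE b).le
  exact sub_nonneg.1 (nonneg_of_mul_nonneg_left (h2.trans h1) (hE r))

theorem lt_of_slope_le {m c t a b : ℝ} (ha : 0 < a) (hab : a ≤ b) {θ₁ θ₂ d₁ d₂ : ℝ → ℝ}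
    (h₁ : ∀ r ∈ Icc a b, HasDerivWithinAt θ₁ (d₁ r) (Icc a b) r)
    (h₂ : ∀ r ∈ Icc a b, HasDerivWithinAt θ₂ (d₂ r) (Icc a b) r)
    (hle : ∀ r ∈ Icc a b, d₁ r - slope m c t r (θ₁ r) ≤ d₂ r - slope m c t r (θ₂ r))
    (hb : θ₂ b < θ₁ b) : ∀ r ∈ Icc a b, θ₂ r < θ₁ r := by
  obtain ⟨E, hE, hA⟩ := exists_antitoneOn_sub ha hab h₁ h₂ hle
  intro r hr
  have h1 := hA hr (right_mem_Icc.2 hab) hr.2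
  have h2 : 0 < (θ₁ b - θ₂ b) * E b := mul_pos (sub_pos.2 hb) (hE b)
  exact sub_pos.1 (pos_of_mul_pos_left (h2.trans_le h1) (hE r).le)

theorem eq_of_slope_le {m c t a b : ℝ} (ha : 0 < a) (hab : a ≤ b) {θ₁ θ₂ d₁ d₂ : ℝ → ℝ}
    (h₁ : ∀ r ∈ Icc a b, HasDerivWithinAt θ₁ (d₁ r) (Icc a b) r)
    (h₂ : ∀ r ∈ Icc a b, HasDerivWithinAt θ₂ (d₂ r) (Icc a b) r)
    (hle : ∀ r ∈ Icc a b, d₁ r - slope m c t r (θ₁ r) ≤ d₂ r - slope m c t r (θ₂ r))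
    (hb : θ₂ b ≤ θ₁ b) (heq : θ₁ a = θ₂ a) : ∀ r ∈ Icc a b, θ₁ r = θ₂ r := by
  obtain ⟨E, hE, hA⟩ := exists_antitoneOn_sub ha hab h₁ h₂ hle
  intro r hr
  refine le_antisymm ?_ (le_of_slope_le ha hab h₁ h₂ hle hb r hr)
  have h1 := hA (left_mem_Icc.2 hab) hr hr.1
  simp only [heq, sub_self, zero_mul] at h1
  exact sub_nonpos.1 (nonpos_of_mul_nonpos_left h1 (hE r))

/-! ### The phase normalised at the right end, and its barriers -/

theorem exists_phase {m c t a b : ℝ} (hm : 0 ≤ m) (hc : 0 ≤ c) (ha : 0 < a) (hab : a ≤ b) :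
    ∃ θ : ℝ → ℝ, θ b = 0 ∧
      ∀ r ∈ Icc a b, HasDerivWithinAt θ (slope m c t r (θ r)) (Icc a b) r := by
  -- The same `M` bounds the field and its Lipschitz constant for all phases, so one Picard–Lindelöf
  -- step on a ball of radius `M (b - a)` covers the whole interval.
  set M : ℝ := c / a ^ 2 + |t| + m / a + 1
  have hM : 0 ≤ M := by positivity
  have hP : IsPicardLindelof (fun r x => slope m c t r x) (⟨b, right_mem_Icc.2 hab⟩ : Icc a b) 0
      (M * (b - a)).toNNReal 0 M.toNNReal M.toNNReal := by
    refine ⟨fun r hr => ?_, fun x _ => ?_, fun r hr x _ => ?_, ?_⟩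
    · refine LipschitzOnWith.of_dist_le_mul fun x _ y _ => ?_
      rw [Real.dist_eq, Real.dist_eq, slope_sub, abs_mul, Real.coe_toNNReal _ hM]
      exact mul_le_mul_of_nonneg_right (abs_slopeQuot_le hm hc ha hr.1 _ _) (abs_nonneg _)
    · have hr : ∀ r ∈ Icc a b, r ≠ 0 := fun r hr => (ha.trans_le hr.1).ne'
      have hr2 : ∀ r ∈ Icc a b, r ^ 2 ≠ 0 := fun r hx => pow_ne_zero 2 (hr r hx)
      unfold slope
      exact ((((continuousOn_const.div (continuousOn_id.pow 2) hr2).sub continuousOn_const).mul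
        continuousOn_const).sub ((continuousOn_const.div continuousOn_id hr).mul
        continuousOn_const)).sub continuousOn_const
    · rw [Real.coe_toNNReal _ hM]
      exact abs_slope_le hm hc ha hr.1 x
    · have : 0 ≤ b - a := sub_nonneg.2 hab
      simp [Real.coe_toNNReal _ hM, Real.coe_toNNReal _ (mul_nonneg hM this), this]
  obtain ⟨θ, h0, h⟩ := hP.exists_eq_forall_mem_Icc_hasDerivWithinAt₀
  exact ⟨θ, h0, h⟩

/-- The phase of the solution on `[a, b]` whose derivative vanishes at `b`. -/
noncomputable def phase (m c a b t : ℝ) : ℝ → ℝ :=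
  Classical.epsilon fun θ : ℝ → ℝ => θ b = 0 ∧
    ∀ r ∈ Icc a b, HasDerivWithinAt θ (slope m c t r (θ r)) (Icc a b) r

theorem phase_right {m c a b : ℝ} (hm : 0 ≤ m) (hc : 0 ≤ c) (ha : 0 < a) (hab : a ≤ b) (t : ℝ) :
    phase m c a b t b = 0 :=
  (Classical.epsilon_spec (exists_phase (t := t) hm hc ha hab)).1

theorem hasDerivWithinAt_phase {m c a b : ℝ} (hm : 0 ≤ m) (hc : 0 ≤ c) (ha : 0 < a)
    (hab : a ≤ b) (t : ℝ) : ∀ r ∈ Icc a b, HasDerivWithinAt (phase m c a b t)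
      (slope m c t r (phase m c a b t r)) (Icc a b) r :=
  (Classical.epsilon_spec (exists_phase (t := t) hm hc ha hab)).2

/-- The phase at the left end point. -/
noncomputable def endPhase (m c a b t : ℝ) : ℝ := phase m c a b t a

/-- Zeros of the solution are crossed in one direction only, at a speed independent of the
parameters. Constant odd multiples of `π / 2` are therefore strict barriers. -/
theorem slope_of_cos_eq_zero {m c t r x : ℝ} (hx : cos x = 0) : slope m c t r x = -1 := by
  have := sin_sq_add_cos_sq x
  simp only [hx] at this
  simp only [slope, hx]
  linarith

theorem neg_pi_div_two_lt_phase {m c a b : ℝ} (hm : 0 ≤ m) (hc : 0 ≤ c) (ha : 0 < a)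
    (hab : a ≤ b) (t : ℝ) {r : ℝ} (hr : r ∈ Icc a b) : -(π / 2) < phase m c a b t r := by
  refine lt_of_slope_le (m := m) (c := c) (t := t) ha hab
    (hasDerivWithinAt_phase hm hc ha hab t)
    (fun r _ => hasDerivWithinAt_const r (Icc a b) (-(π / 2))) (fun r _ => ?_) ?_ r hr
  · rw [slope_of_cos_eq_zero (x := -(π / 2)) (by simp)]; linarith
  · rw [phase_right hm hc ha hab]; linarith [pi_pos]

theorem neg_pi_div_two_lt_endPhase {m c a b : ℝ} (hm : 0 ≤ m) (hc : 0 ≤ c) (ha : 0 < a)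
    (hab : a ≤ b) (t : ℝ) : -(π / 2) < endPhase m c a b t :=
  neg_pi_div_two_lt_phase hm hc ha hab t (left_mem_Icc.2 hab)

/-- A phase at or above `π / 2` at `r` stays so down to `a`. The bound at `a` then forces it to be
constantly `π / 2` on `[a, r]`, against slope `-1`. -/
theorem phase_lt_pi_div_two {m c a b t : ℝ} (hm : 0 ≤ m) (hc : 0 ≤ c) (ha : 0 < a)
    (hab : a ≤ b) (h : endPhase m c a b t ≤ π / 2) {r : ℝ} (hr : r ∈ Ioc a b) :
    phase m c a b t r < π / 2 := by
  by_contra! hge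
  have hsub : Icc a r ⊆ Icc a b := Icc_subset_Icc_right hr.2
  have h1 : ∀ x ∈ Icc a r, HasDerivWithinAt (phase m c a b t)
      (slope m c t x (phase m c a b t x)) (Icc a r) x := fun x hx =>
    (hasDerivWithinAt_phase hm hc ha hab t x (hsub hx)).mono hsub
  have h2 : ∀ x ∈ Icc a r, HasDerivWithinAt (fun _ : ℝ => π / 2) 0 (Icc a r) x := fun x _ =>
    hasDerivWithinAt_const x (Icc a r) (π / 2)
  have h3 : ∀ x ∈ Icc a r, slope m c t x (phase m c a b t x) - slope m c t x (phase m c a b t x)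
      ≤ 0 - slope m c t x (π / 2) := fun x _ => by
    rw [slope_of_cos_eq_zero (x := π / 2) (by simp)]; linarith
  have h4 : phase m c a b t a = π / 2 := le_antisymm h
    (le_of_slope_le ha hr.1.le h1 h2 h3 hge a (left_mem_Icc.2 hr.1.le))
  have h5 := eq_of_slope_le ha hr.1.le h1 h2 h3 hge h4
  have hmem := left_mem_Icc.2 hr.1.le
  have h6 := (uniqueDiffOn_Icc hr.1 a hmem).eq_deriv _
    ((h2 a hmem).congr h5 h4) (h1 a hmem)
  rw [h4, slope_of_cos_eq_zero (by simp)] at h6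
  norm_num at h6

/-! ### Dependence of the end phase on the parameters -/

theorem endPhase_lt_of_potential_le {m c₁ c₂ a b t₁ t₂ : ℝ} (hm : 0 ≤ m) (hc₁ : 0 ≤ c₁)
    (hc₂ : 0 ≤ c₂) (ha : 0 < a) (hab : a < b)
    (hle : ∀ r ∈ Icc a b, c₂ / r ^ 2 - t₂ ≤ c₁ / r ^ 2 - t₁)
    (hlt : c₂ / b ^ 2 - t₂ < c₁ / b ^ 2 - t₁) :
    endPhase m c₁ a b t₁ < endPhase m c₂ a b t₂ := by
  have h1 := hasDerivWithinAt_phase hm hc₂ ha hab.le t₂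
  have h2 := hasDerivWithinAt_phase hm hc₁ ha hab.le t₁
  have h3 : ∀ r ∈ Icc a b, slope m c₂ t₂ r (phase m c₂ a b t₂ r) -
      slope m c₁ t₁ r (phase m c₂ a b t₂ r) ≤ slope m c₁ t₁ r (phase m c₁ a b t₁ r) -
      slope m c₁ t₁ r (phase m c₁ a b t₁ r) := fun r hr => by
    have := mul_le_mul_of_nonneg_right (hle r hr) (sq_nonneg (cos (phase m c₂ a b t₂ r)))
    simp only [slope]
    linarith
  have hb : phase m c₁ a b t₁ b ≤ phase m c₂ a b t₂ b := by
    rw [phase_right hm hc₁ ha hab.le, phase_right hm hc₂ ha hab.le]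
  refine (le_of_slope_le ha hab.le h1 h2 h3 hb a (left_mem_Icc.2 hab.le)).lt_of_ne fun heq => ?_
  -- Equal end phases would make the phases agree throughout. Their derivatives at `b`, where the
  -- phase is `0`, are the potentials there, and these differ.
  have h5 := eq_of_slope_le ha hab.le h1 h2 h3 hb heq.symm
  have hmem := right_mem_Icc.2 hab.le
  have h6 := (uniqueDiffOn_Icc hab b hmem).eq_deriv _ ((h2 b hmem).congr h5 (h5 b hmem))
    (h1 b hmem)
  rw [phase_right hm hc₁ ha hab.le, phase_right hm hc₂ ha hab.le] at h6
  simp only [slope, cos_zero, sin_zero] at h6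
  linarith

theorem strictMono_endPhase {m c a b : ℝ} (hm : 0 ≤ m) (hc : 0 ≤ c) (ha : 0 < a) (hab : a < b) :
    StrictMono (endPhase m c a b) := fun t₁ t₂ h =>
  endPhase_lt_of_potential_le hm hc hc ha hab (fun r _ => by linarith) (by linarith)

theorem endPhase_lt_of_lt {m c₁ c₂ a b : ℝ} (hm : 0 ≤ m) (hc₁ : 0 ≤ c₁) (h : c₁ < c₂)
    (ha : 0 < a) (hab : a < b) (t : ℝ) : endPhase m c₂ a b t < endPhase m c₁ a b t := by
  have hb : 0 < b := ha.trans hab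
  refine endPhase_lt_of_potential_le hm (hc₁.trans h.le) hc₁ ha hab (fun r hr => ?_) ?_
  · have : 0 < r := ha.trans_le hr.1
    gcongr
  · gcongr

/-- The phase for `t₀` plus `|t - t₀| exp ((M + 1) (b - r))` is a supersolution for `t`: `M` pays
for the Lipschitz error, the extra `1` for the change of parameter. -/
theorem endPhase_le_add {m c a b : ℝ} (hm : 0 ≤ m) (hc : 0 ≤ c) (ha : 0 < a) (hab : a < b)
    (t₀ t : ℝ) : endPhase m c a b t ≤ endPhase m c a b t₀ +
      |t - t₀| * exp ((c / a ^ 2 + |t| + m / a + 1 + 1) * (b - a)) := by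
  set M := c / a ^ 2 + |t| + m / a + 1
  have hM : 0 ≤ M := by positivity
  set ε := |t - t₀|
  have hε : 0 ≤ ε := abs_nonneg _
  have h0 := hasDerivWithinAt_phase hm hc ha hab.le t₀
  have hE : ∀ r : ℝ, HasDerivAt (fun r => ε * exp ((M + 1) * (b - r)))
      (ε * (exp ((M + 1) * (b - r)) * ((M + 1) * (-1)))) r := fun r =>
    ((((hasDerivAt_id r).const_sub b).const_mul (M + 1)).exp).const_mul ε
  refine le_of_slope_le (m := m) (c := c) (t := t) ha hab.le
    (fun r hr => (h0 r hr).add (hE r).hasDerivWithinAt)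
    (hasDerivWithinAt_phase hm hc ha hab.le t) (fun r hr => ?_) ?_ a (left_mem_Icc.2 hab.le)
  · set x := phase m c a b t₀ r
    set e := exp ((M + 1) * (b - r)) with he
    have he1 : 1 ≤ e := by
      rw [he, one_le_exp_iff]
      exact mul_nonneg (by linarith) (sub_nonneg.2 hr.2)
    have e1 : slope m c t₀ r x - slope m c t r x ≤ ε := by
      have h1 : slope m c t₀ r x - slope m c t r x = (t - t₀) * cos x ^ 2 := by
        simp only [slope]; ring
      rw [h1]
      refine (le_abs_self _).trans ?_
      rw [abs_mul, abs_of_nonneg (sq_nonneg (cos x))]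
      exact mul_le_of_le_one_right hε (cos_sq_le_one x)
    have e2 : slope m c t r x - slope m c t r (x + ε * e) ≤ M * (ε * e) := by
      rw [slope_sub]
      refine (le_abs_self _).trans ?_
      have h2 : |x - (x + ε * e)| = ε * e := by
        rw [sub_add_cancel_left, abs_neg, abs_of_nonneg (by positivity)]
      rw [abs_mul, h2]
      exact mul_le_mul_of_nonneg_right (abs_slopeQuot_le hm hc ha hr.1 _ _) (by positivity)
    have e3 : ε ≤ ε * e := le_mul_of_one_le_right hε he1
    have e4 : (phase m c a b t₀ + fun r => ε * exp ((M + 1) * (b - r))) r = x + ε * e := rfl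
    rw [e4]
    linarith
  · have e4 : (phase m c a b t₀ + fun r => ε * exp ((M + 1) * (b - r))) b
      = phase m c a b t₀ b + ε * exp ((M + 1) * (b - b)) := rfl
    rw [e4, phase_right hm hc ha hab.le, phase_right hm hc ha hab.le]
    positivity

theorem continuous_endPhase {m c a b : ℝ} (hm : 0 ≤ m) (hc : 0 ≤ c) (ha : 0 < a) (hab : a < b) :
    Continuous (endPhase m c a b) := by
  rw [continuous_iff_continuousAt]
  intro t₀
  set B : ℝ → ℝ := fun t => exp ((c / a ^ 2 + |t| + m / a + 1 + 1) * (b - a)) with hB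
  have hBc : Continuous B := by fun_prop
  have hlim : Filter.Tendsto (fun t => |t - t₀| * (B t + B t₀)) (nhds t₀) (nhds 0) := by
    have : Continuous fun t => |t - t₀| * (B t + B t₀) := by fun_prop
    simpa using this.tendsto t₀
  refine tendsto_iff_dist_tendsto_zero.2 (squeeze_zero (fun _ => dist_nonneg) (fun t => ?_) hlim)
  have h1 := endPhase_le_add hm hc ha hab t₀ t
  have h2 := endPhase_le_add hm hc ha hab t t₀
  rw [abs_sub_comm t₀ t] at h2
  have p1 : 0 ≤ |t - t₀| * B t := mul_nonneg (abs_nonneg _) (exp_pos _).le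
  have p2 : 0 ≤ |t - t₀| * B t₀ := mul_nonneg (abs_nonneg _) (exp_pos _).le
  rw [Real.dist_eq, abs_le, mul_add]
  constructor <;> simp only [hB] at * <;> linarith

/-- A straight line from `min η 0` at `a` to `0` at `b` is a supersolution once `t` is negative
enough. -/
theorem exists_endPhase_le {m c a b : ℝ} (hm : 0 ≤ m) (hc : 0 ≤ c) (ha : 0 < a) (hab : a < b)
    {η : ℝ} (hη : -(π / 2) < η) : ∃ t, endPhase m c a b t ≤ η := by
  set x := min η 0 with hx
  have hx0 : x ≤ 0 := min_le_right _ _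
  have hx1 : -(π / 2) < x := lt_min hη (by linarith [pi_pos])
  have hδ : 0 < b - a := sub_pos.2 hab
  have hcos : 0 < cos x := cos_pos_of_mem_Ioo ⟨hx1, by linarith [pi_pos]⟩
  -- Chosen so that `-t cos² x` equals the line's descent rate plus `1`; the `1` absorbs `sin²`.
  refine ⟨-((-x / (b - a) + 1) / cos x ^ 2), ?_⟩
  set t := -((-x / (b - a) + 1) / cos x ^ 2) with ht
  have ht' : -t * cos x ^ 2 = -x / (b - a) + 1 := by rw [ht]; field_simp
  have ht0 : 0 ≤ -t := by
    rw [ht, neg_neg]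
    have : 0 ≤ -x / (b - a) := div_nonneg (by linarith) hδ.le
    positivity
  have hd : ∀ r : ℝ, HasDerivAt (fun r => x / (b - a) * (b - r)) (x / (b - a) * (-1)) r :=
    fun r => ((hasDerivAt_id r).const_sub b).const_mul _
  have key := le_of_slope_le (m := m) (c := c) (t := t) ha hab.le
    (fun r _ => (hd r).hasDerivWithinAt)
    (hasDerivWithinAt_phase hm hc ha hab.le t) (fun r hr => ?_) ?_ a (left_mem_Icc.2 hab.le)
  · rw [div_mul_cancel₀ _ hδ.ne'] at key
    exact key.trans (min_le_left _ _)
  · have hr0 : 0 < r := ha.trans_le hr.1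
    set y := x / (b - a) * (b - r) with hy
    have hy0 : y ≤ 0 := mul_nonpos_of_nonpos_of_nonneg
      (div_nonpos_of_nonpos_of_nonneg hx0 hδ.le) (sub_nonneg.2 hr.2)
    have hxy : x ≤ y := by
      have h1 : x = x / (b - a) * (b - a) := by field_simp
      have h2 : x / (b - a) ≤ 0 := div_nonpos_of_nonpos_of_nonneg hx0 hδ.le
      have h3 := mul_le_mul_of_nonpos_left (sub_le_sub_left hr.1 b) h2
      linarith
    have hcy : cos x ≤ cos y := by
      rw [← cos_neg x, ← cos_neg y]
      exact cos_le_cos_of_nonneg_of_le_pi (by linarith) (by linarith [pi_pos]) (by linarith)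
    have hsy : sin y ≤ 0 := sin_nonpos_of_nonpos_of_neg_pi_le hy0 (by linarith [pi_pos])
    have h1 : -t * cos x ^ 2 ≤ -t * cos y ^ 2 := by gcongr
    have h2 : m / r * (sin y * cos y) ≤ 0 := mul_nonpos_of_nonneg_of_nonpos
      (div_nonneg hm hr0.le) (mul_nonpos_of_nonpos_of_nonneg hsy (hcos.le.trans hcy))
    have h3 : 0 ≤ c / r ^ 2 * cos y ^ 2 := by positivity
    have h4 := sin_sq_le_one y
    have h5 : x / (b - a) * (-1) = -x / (b - a) := by ring
    rw [sub_self, h5]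
    simp only [slope]
    linarith
  · rw [phase_right hm hc ha hab.le]; simp

/-! ### Explicit comparison phases and large end phases -/

/-- The increasing homeomorphism with `tan (rescale σ x) = σ * tan x` that fixes the multiples
of `π / 2`. -/
noncomputable def rescale (σ x : ℝ) : ℝ :=
  x + arctan ((σ - 1) * (sin x * cos x) / (cos x ^ 2 + σ * sin x ^ 2))

theorem rescale_eq_self {σ x : ℝ} (h : sin x * cos x = 0) : rescale σ x = x := by
  simp [rescale, h]

theorem cos_sq_add_mul_sin_sq_pos {σ : ℝ} (hσ : 0 < σ) (x : ℝ) :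
    0 < cos x ^ 2 + σ * sin x ^ 2 := by
  rcases eq_or_ne (cos x) 0 with h | h
  · have := sin_sq_add_cos_sq x
    rw [h] at this ⊢
    have : sin x ^ 2 = 1 := by linarith
    rw [this]; linarith
  · positivity

theorem one_add_sq_rescale {σ : ℝ} (hσ : 0 < σ) (x : ℝ) :
    1 + ((σ - 1) * (sin x * cos x) / (cos x ^ 2 + σ * sin x ^ 2)) ^ 2 =
      (cos x ^ 2 + σ ^ 2 * sin x ^ 2) / (cos x ^ 2 + σ * sin x ^ 2) ^ 2 := by
  have hn := (cos_sq_add_mul_sin_sq_pos hσ x).ne'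
  have h := sin_sq_add_cos_sq x
  field_simp
  linear_combination (cos x ^ 2 + σ ^ 2 * sin x ^ 2) * h

theorem hasDerivAt_rescale {σ : ℝ} (hσ : 0 < σ) (x : ℝ) :
    HasDerivAt (rescale σ) (σ / (cos x ^ 2 + σ ^ 2 * sin x ^ 2)) x := by
  have hn := (cos_sq_add_mul_sin_sq_pos hσ x).ne'
  have hn2 := (cos_sq_add_mul_sin_sq_pos (pow_pos hσ 2) x).ne'
  have h := sin_sq_add_cos_sq x
  have h1 := (((hasDerivAt_sin x).mul (hasDerivAt_cos x)).const_mul (σ - 1)).div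
    (((hasDerivAt_cos x).pow 2).add (((hasDerivAt_sin x).pow 2).const_mul σ)) hn
  refine ((hasDerivAt_id x).add h1.arctan).congr_deriv ?_
  simp only [Pi.mul_apply, Pi.add_apply, Pi.pow_apply, Pi.div_apply]
  rw [one_add_sq_rescale hσ]
  field_simp
  have hs : sin x ^ 2 = 1 - cos x ^ 2 := by linarith
  simp only [Nat.cast_ofNat, Nat.add_one_sub_one, pow_one]
  have hs3 : sin x ^ 4 = (1 - cos x ^ 2) ^ 2 := by rw [← hs]; ring
  ring_nf
  simp only [hs3, hs]
  ring

theorem cos_rescale {σ : ℝ} (hσ : 0 < σ) (x : ℝ) :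
    cos (rescale σ x) ^ 2 = cos x ^ 2 / (cos x ^ 2 + σ ^ 2 * sin x ^ 2) ∧
    sin (rescale σ x) * cos (rescale σ x) =
      σ * (sin x * cos x) / (cos x ^ 2 + σ ^ 2 * sin x ^ 2) ∧
    sin (rescale σ x) ^ 2 = σ ^ 2 * sin x ^ 2 / (cos x ^ 2 + σ ^ 2 * sin x ^ 2) := by
  have hn := (cos_sq_add_mul_sin_sq_pos hσ x).ne'
  have hn2 := (cos_sq_add_mul_sin_sq_pos (pow_pos hσ 2) x).ne'
  have h := sin_sq_add_cos_sq x
  set y := (σ - 1) * (sin x * cos x) / (cos x ^ 2 + σ * sin x ^ 2) with hy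
  have hyn : y * (cos x ^ 2 + σ * sin x ^ 2) = (σ - 1) * (sin x * cos x) :=
    div_mul_cancel₀ _ hn
  have hy1 : cos x - y * sin x = cos x / (cos x ^ 2 + σ * sin x ^ 2) := by
    rw [eq_div_iff hn]
    linear_combination cos x * h - sin x * hyn
  have hy2 : sin x + y * cos x = σ * sin x / (cos x ^ 2 + σ * sin x ^ 2) := by
    rw [eq_div_iff hn]
    linear_combination σ * sin x * h + cos x * hyn
  have hsq := cos_sq_arctan y
  have hsin : sin (arctan y) = y * cos (arctan y) := by
    rw [sin_arctan, cos_arctan]; ring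
  have hc : cos (rescale σ x) = cos (arctan y) * (cos x / (cos x ^ 2 + σ * sin x ^ 2)) := by
    rw [rescale, cos_add, ← hy, hsin, ← hy1]; ring
  have hs : sin (rescale σ x) = cos (arctan y) * (σ * sin x / (cos x ^ 2 + σ * sin x ^ 2)) := by
    rw [rescale, sin_add, ← hy, hsin, ← hy2]; ring
  rw [one_add_sq_rescale hσ, one_div_div] at hsq
  refine ⟨?_, ?_, ?_⟩
  · rw [hc, mul_pow, hsq]; field_simp
  · have : sin (rescale σ x) * cos (rescale σ x) = cos (arctan y) ^ 2 *
      ((σ * sin x / (cos x ^ 2 + σ * sin x ^ 2)) * (cos x / (cos x ^ 2 + σ * sin x ^ 2))) := by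
      rw [hc, hs]; ring
    rw [this, hsq]; field_simp
  · rw [hs, mul_pow, hsq]; field_simp

theorem slope_rescale {σ : ℝ} (hσ : 0 < σ) (m c r x : ℝ) :
    slope m c (σ ^ 2) r (rescale σ x) =
      (c / r ^ 2 * cos x ^ 2 - m / r * σ * (sin x * cos x) - σ ^ 2) /
        (cos x ^ 2 + σ ^ 2 * sin x ^ 2) := by
  obtain ⟨h1, h2, h3⟩ := cos_rescale hσ x
  have hs : sin x ^ 2 = 1 - cos x ^ 2 := by linarith [sin_sq_add_cos_sq x]
  rw [slope, h1, h2, h3, hs]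
  ring

theorem hasDerivAt_rescale_linear {σ : ℝ} (hσ : 0 < σ) (k b r : ℝ) :
    HasDerivAt (fun r => rescale σ (k * (b - r)))
      (σ / (cos (k * (b - r)) ^ 2 + σ ^ 2 * sin (k * (b - r)) ^ 2) * (k * (-1))) r := by
  have h : HasDerivAt (fun r => k * (b - r)) (k * (-1)) r :=
    ((hasDerivAt_id r).const_sub b).const_mul k
  exact (hasDerivAt_rescale hσ (k * (b - r))).comp r h

theorem abs_sin_mul_cos_le_one (x : ℝ) : |sin x * cos x| ≤ 1 := by
  rw [abs_mul]
  exact mul_le_one₀ (abs_sin_le_one _) (abs_nonneg _) (abs_cos_le_one _)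

/-- For `m = c = 0` and `t = σ²` the exact phase is `rescale σ (σ (b - r))`. Replacing the speed `σ`
by a smaller `k` leaves room for the two lower-order terms. -/
theorem rescale_le_endPhase {m c a b σ k : ℝ} (hm : 0 ≤ m) (hc : 0 ≤ c) (ha : 0 < a)
    (hab : a < b) (hσ : 0 < σ) (hk : k * σ ≤ σ ^ 2 - m / a * σ - c / a ^ 2) :
    rescale σ (k * (b - a)) ≤ endPhase m c a b (σ ^ 2) := by
  refine le_of_slope_le (m := m) (c := c) (t := σ ^ 2) ha hab.le
    (hasDerivWithinAt_phase hm hc ha hab.le (σ ^ 2))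
    (fun r _ => (hasDerivAt_rescale_linear hσ k b r).hasDerivWithinAt) (fun r hr => ?_) ?_ a
    (left_mem_Icc.2 hab.le)
  · have hr0 : 0 < r := ha.trans_le hr.1
    set x := k * (b - r)
    have hn := cos_sq_add_mul_sin_sq_pos (pow_pos hσ 2) x
    rw [slope_rescale hσ, sub_self, div_mul_eq_mul_div, ← sub_div]
    refine div_nonneg ?_ hn.le
    have h1 : c / r ^ 2 * cos x ^ 2 ≤ c / a ^ 2 := by
      have : c / r ^ 2 ≤ c / a ^ 2 := by
        have := hr.1
        gcongr
      exact (mul_le_of_le_one_right (by positivity) (cos_sq_le_one x)).trans this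
    have h2 : m / r * σ * -(sin x * cos x) ≤ m / a * σ := by
      have h3 : m / r * σ ≤ m / a * σ := by
        have := hr.1
        gcongr
      exact (mul_le_of_le_one_right (by positivity)
        (neg_le.1 (abs_le.1 (abs_sin_mul_cos_le_one x)).1)).trans h3
    linarith
  · rw [phase_right hm hc ha hab.le]; simp [rescale]

theorem endPhase_le_rescale {m c a b σ k : ℝ} (hm : 0 ≤ m) (hc : 0 ≤ c) (ha : 0 < a)
    (hab : a < b) (hσ : 0 < σ) (hk : σ + m / a ≤ k) :
    endPhase m c a b (σ ^ 2) ≤ rescale σ (k * (b - a)) := by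
  refine le_of_slope_le (m := m) (c := c) (t := σ ^ 2) ha hab.le
    (fun r _ => (hasDerivAt_rescale_linear hσ k b r).hasDerivWithinAt)
    (hasDerivWithinAt_phase hm hc ha hab.le (σ ^ 2)) (fun r hr => ?_) ?_ a
    (left_mem_Icc.2 hab.le)
  · have hr0 : 0 < r := ha.trans_le hr.1
    set x := k * (b - r)
    have hn := cos_sq_add_mul_sin_sq_pos (pow_pos hσ 2) x
    rw [slope_rescale hσ, sub_self, div_mul_eq_mul_div, ← sub_div]
    refine div_nonpos_of_nonpos_of_nonneg ?_ hn.le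
    have h1 : 0 ≤ c / r ^ 2 * cos x ^ 2 := by positivity
    have h2 : m / r * σ * (sin x * cos x) ≤ m / a * σ := by
      have h3 : m / r * σ ≤ m / a * σ := by
        have := hr.1
        gcongr
      exact (mul_le_of_le_one_right (by positivity)
        (abs_le.1 (abs_sin_mul_cos_le_one x)).2).trans h3
    have h4 := mul_le_mul_of_nonneg_right hk hσ.le
    linarith
  · rw [phase_right hm hc ha hab.le]; simp [rescale]

theorem exists_le_endPhase {m c a b : ℝ} (hm : 0 ≤ m) (hc : 0 ≤ c) (ha : 0 < a) (hab : a < b) :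
    ∃ t, 3 * π / 2 ≤ endPhase m c a b t := by
  have hδ : 0 < b - a := sub_pos.2 hab
  -- The largest level needed is `η + π` with `η = π / 2`; `rescale` fixes `3π / 2`.
  set k := 3 * π / 2 / (b - a) with hk
  have hk0 : 0 < k := by positivity
  have hσ : 0 < k + m / a + c / a ^ 2 + 1 := by positivity
  refine ⟨(k + m / a + c / a ^ 2 + 1) ^ 2, ?_⟩
  have hc' : cos (3 * π / 2) = 0 := by
    rw [show 3 * π / 2 = π / 2 + π by ring, cos_add_pi, cos_pi_div_two, neg_zero]
  have h := rescale_le_endPhase (k := k) hm hc ha hab hσ (by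
    have h1 : 0 ≤ c / a ^ 2 := by positivity
    have h2 : 0 ≤ m / a := by positivity
    have h3 : 0 ≤ c / a ^ 2 * (k + m / a + c / a ^ 2) := by positivity
    linarith)
  rwa [hk, div_mul_cancel₀ _ hδ.ne', rescale_eq_self (by rw [hc', mul_zero])] at h

theorem exists_endPhase_eq {m c a b : ℝ} (hm : 0 ≤ m) (hc : 0 ≤ c) (ha : 0 < a) (hab : a < b)
    {η : ℝ} (h1 : -(π / 2) < η) (h2 : η ≤ 3 * π / 2) : ∃ t, endPhase m c a b t = η := by
  obtain ⟨t₁, ht₁⟩ := exists_endPhase_le hm hc ha hab h1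
  obtain ⟨t₂, ht₂⟩ := exists_le_endPhase hm hc ha hab
  exact intermediate_value_univ t₁ t₂ (continuous_endPhase hm hc ha hab) ⟨ht₁, h2.trans ht₂⟩

/-! ### Phases and solutions of the equation -/

/-- `v` and `w = v'` solve `v'' = -(m / r) v' + (c / r ^ 2) v - t v` on `[a, b]`. -/
def IsRadialSolution (m c a b t : ℝ) (v w : ℝ → ℝ) : Prop :=
  (∀ r ∈ Icc a b, HasDerivWithinAt v (w r) (Icc a b) r) ∧
  ∀ r ∈ Icc a b, HasDerivWithinAt w (-(m / r) * w r + c / r ^ 2 * v r - t * v r) (Icc a b) r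

/-- The logarithmic derivative of the amplitude of a solution with phase `x`. -/
noncomputable def ampRate (m c t r x : ℝ) : ℝ :=
  (1 + c / r ^ 2 - t) * (sin x * cos x) - m / r * sin x ^ 2

theorem continuousOn_ampRate {m c t a b : ℝ} (ha : 0 < a) {θ : ℝ → ℝ}
    (h : ContinuousOn θ (Icc a b)) : ContinuousOn (fun r => ampRate m c t r (θ r)) (Icc a b) := by
  have hr : ∀ r ∈ Icc a b, r ≠ 0 := fun r hr => (ha.trans_le hr.1).ne'
  have hr2 : ∀ r ∈ Icc a b, r ^ 2 ≠ 0 := fun r hx => pow_ne_zero 2 (hr r hx)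
  have hs := continuous_sin.comp_continuousOn h
  have hc := continuous_cos.comp_continuousOn h
  exact (((continuousOn_const.add (continuousOn_const.div (continuousOn_id.pow 2) hr2)).sub
    continuousOn_const).mul (hs.mul hc)).sub
    ((continuousOn_const.div continuousOn_id hr).mul (hs.pow 2))

theorem exists_isRadialSolution {m c a b : ℝ} (hm : 0 ≤ m) (hc : 0 ≤ c) (ha : 0 < a)
    (hab : a ≤ b) (t : ℝ) : ∃ ρ : ℝ → ℝ, (∀ r, 0 < ρ r) ∧ IsRadialSolution m c a b t
      (fun r => ρ r * cos (phase m c a b t r)) (fun r => ρ r * sin (phase m c a b t r)) := by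
  have hθ := hasDerivWithinAt_phase hm hc ha hab t
  have hθc : ContinuousOn (phase m c a b t) (Icc a b) := fun r hr => (hθ r hr).continuousWithinAt
  obtain ⟨ρ, hρ, hρ'⟩ := exists_integrating_factor hab
    (continuousOn_ampRate (m := m) (c := c) (t := t) ha hθc).neg
  refine ⟨ρ, hρ, fun r hr => ?_, fun r hr => ?_⟩
  · refine ((hρ' r hr).mul (hθ r hr).cos).congr_deriv ?_
    have h := sin_sq_add_cos_sq (phase m c a b t r)
    simp only [ampRate, slope, Pi.neg_apply]
    linear_combination ρ r * sin (phase m c a b t r) * h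
  · refine ((hρ' r hr).mul (hθ r hr).sin).congr_deriv ?_
    have h := sin_sq_add_cos_sq (phase m c a b t r)
    simp only [ampRate, slope, Pi.neg_apply]
    linear_combination ρ r * ((c / r ^ 2 - t) * cos (phase m c a b t r) -
      m / r * sin (phase m c a b t r)) * h

theorem IsRadialSolution.exists_amplitude {m c a b t : ℝ} {v w : ℝ → ℝ}
    (h : IsRadialSolution m c a b t v w) (hm : 0 ≤ m) (hc : 0 ≤ c) (ha : 0 < a)
    (hab : a ≤ b) (hw : w b = 0) : ∃ A : ℝ → ℝ,
      (∀ r ∈ Icc a b, v r = A r * cos (phase m c a b t r) ∧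
        w r = A r * sin (phase m c a b t r)) ∧
      (A a = 0 → ∀ r ∈ Icc a b, A r = 0) := by
  have hθ := hasDerivWithinAt_phase hm hc ha hab t
  have hθb := phase_right hm hc ha hab t
  set θ := phase m c a b t
  have hθc : ContinuousOn θ (Icc a b) := fun r hr => (hθ r hr).continuousWithinAt
  have hr0 : ∀ r ∈ Icc a b, r ≠ 0 := fun r hr => (ha.trans_le hr.1).ne'
  have hr2 : ∀ r ∈ Icc a b, r ^ 2 ≠ 0 := fun r hx => pow_ne_zero 2 (hr0 r hx)
  have hsc := continuous_sin.comp_continuousOn hθc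
  have hcc := continuous_cos.comp_continuousOn hθc
  have hκ : ContinuousOn (fun r => -(m / r) * cos (θ r) ^ 2 -
      (1 + c / r ^ 2 - t) * (sin (θ r) * cos (θ r))) (Icc a b) :=
    ((continuousOn_const.div continuousOn_id hr0).neg.mul (hcc.pow 2)).sub
      (((continuousOn_const.add (continuousOn_const.div (continuousOn_id.pow 2) hr2)).sub
        continuousOn_const).mul (hsc.mul hcc))
  -- The component of `(v, w)` orthogonal to `(cos θ, sin θ)` solves a homogeneous linear equation
  -- and vanishes at `b`.
  have hg : ∀ r ∈ Icc a b, w r * cos (θ r) - v r * sin (θ r) = 0 := by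
    refine eq_zero_of_linear (D := fun r => w r * cos (θ r) - v r * sin (θ r)) hκ
      (fun r hr => ?_) (right_mem_Icc.2 hab) (by simp only [hw, hθb, sin_zero]; ring)
    refine (((h.2 r hr).mul (hθ r hr).cos).sub ((h.1 r hr).mul (hθ r hr).sin)).congr_deriv ?_
    have hsq := sin_sq_add_cos_sq (θ r)
    simp only [slope]
    linear_combination (-((c / r ^ 2 - t) * cos (θ r) * v r - m / r * cos (θ r) * w r
      - sin (θ r) * w r)) * hsq
  have hv : ∀ r ∈ Icc a b, v r = (v r * cos (θ r) + w r * sin (θ r)) * cos (θ r) ∧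
      w r = (v r * cos (θ r) + w r * sin (θ r)) * sin (θ r) := fun r hr => by
    have hsq := sin_sq_add_cos_sq (θ r)
    have := hg r hr
    exact ⟨by linear_combination (-v r) * hsq - sin (θ r) * this,
      by linear_combination (-w r) * hsq + cos (θ r) * this⟩
  refine ⟨fun r => v r * cos (θ r) + w r * sin (θ r), hv, fun h0 => ?_⟩
  refine eq_zero_of_linear (D := fun r => v r * cos (θ r) + w r * sin (θ r))
    (continuousOn_ampRate (m := m) (c := c) (t := t) ha hθc) (fun r hr => ?_)
    (left_mem_Icc.2 hab) h0
  refine (((h.1 r hr).mul (hθ r hr).cos).add ((h.2 r hr).mul (hθ r hr).sin)).congr_deriv ?_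
  obtain ⟨e1, e2⟩ := hv r hr
  have e3 := hg r hr
  simp only [ampRate]
  linear_combination slope m c t r (θ r) * e3 + (cos (θ r) - m / r * sin (θ r)) * e2
    + (c / r ^ 2 - t) * sin (θ r) * e1

/-! ### Boundary angle, spectrum and counting of eigenvalues -/

/-- The phase in `(-π / 2, π / 2]` prescribed by the boundary condition `v' = h v`. -/
noncomputable def bcAngle (h : WithTop ℝ) : ℝ := WithTop.recTopCoe (π / 2) arctan h

theorem bcAngle_top : bcAngle ⊤ = π / 2 := rfl

theorem bcAngle_coe (x : ℝ) : bcAngle x = arctan x := rfl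

theorem neg_pi_div_two_lt_bcAngle (h : WithTop ℝ) : -(π / 2) < bcAngle h := by
  induction h with
  | top => rw [bcAngle_top]; linarith [pi_pos]
  | coe x => exact neg_pi_div_two_lt_arctan x

theorem bcAngle_le_pi_div_two (h : WithTop ℝ) : bcAngle h ≤ π / 2 := by
  induction h with
  | top => exact bcAngle_top.le
  | coe x => exact (arctan_lt_pi_div_two x).le

theorem monotone_bcAngle : Monotone bcAngle := by
  intro x y hxy
  induction y with
  | top => exact bcAngle_le_pi_div_two x
  | coe y =>
    induction x with
    | top => simp at hxy
    | coe x => exact arctan_strictMono.monotone (WithTop.coe_le_coe.1 hxy)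

theorem boundary_condition_iff (h : WithTop ℝ) (A x : ℝ) :
    ((∀ c : ℝ, h = (c : WithTop ℝ) → -(A * sin x) + c * (A * cos x) = 0) ∧
      (h = ⊤ → A * cos x = 0)) ↔ A * sin (x - bcAngle h) = 0 := by
  induction h with
  | top => simp [bcAngle_top, sin_sub]
  | coe y =>
    have hy : 0 < √(1 + y ^ 2) := by positivity
    have e : A * sin (x - arctan y) =
        -(-(A * sin x) + y * (A * cos x)) / √(1 + y ^ 2) := by
      rw [sin_sub, sin_arctan, cos_arctan]; ring
    rw [bcAngle_coe, e, div_eq_zero_iff, neg_eq_zero]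
    simp [hy.ne']

theorem mem_radialSpectrum_iff {N : ℕ} (hN : 2 ≤ N) {α β : ℝ} (hα : 0 < α) (hαβ : α < β)
    (h : WithTop ℝ) (l : ℕ) (t : ℝ) : t ∈ radialSpectrum N α β h l ↔
      ∃ n : ℕ, endPhase ((N : ℝ) - 1) ((l : ℝ) * ((l : ℝ) + N - 2)) α β t =
        bcAngle h + n * π := by
  have hN' : (2 : ℝ) ≤ N := by exact_mod_cast hN
  have hm : 0 ≤ (N : ℝ) - 1 := by linarith
  have hl : (0 : ℝ) ≤ l := Nat.cast_nonneg l
  have hc : 0 ≤ (l : ℝ) * ((l : ℝ) + N - 2) := mul_nonneg hl (by linarith)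
  have hmem : α ∈ Icc α β := left_mem_Icc.2 hαβ.le
  have hsin : (∃ n : ℕ, endPhase ((N : ℝ) - 1) ((l : ℝ) * ((l : ℝ) + N - 2)) α β t =
      bcAngle h + n * π) ↔
      sin (phase ((N : ℝ) - 1) ((l : ℝ) * ((l : ℝ) + N - 2)) α β t α - bcAngle h) = 0 := by
    rw [Real.sin_eq_zero_iff]
    constructor
    · rintro ⟨n, hn⟩
      rw [endPhase] at hn
      exact ⟨n, by rw [hn]; push_cast; ring⟩
    · rintro ⟨n, hn⟩
      have h1 := neg_pi_div_two_lt_endPhase hm hc hα hαβ.le t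
      have h2 := bcAngle_le_pi_div_two h
      rw [endPhase] at h1
      -- Negative `n` would put the end phase at or below `π / 2 - π`, under the barrier.
      have h3 : 0 ≤ n := by
        by_contra! hneg
        have h4 : (n : ℝ) ≤ -1 := by exact_mod_cast Int.le_sub_one_of_lt hneg
        have h5 := mul_le_mul_of_nonneg_right h4 pi_pos.le
        linarith
      lift n to ℕ using h3
      refine ⟨n, ?_⟩
      rw [endPhase]
      push_cast at hn
      linarith
  rw [hsin]
  constructor
  · rintro ⟨v, w, hv, hw, hb1, hb2, hb3, r, hr, hvr⟩
    obtain ⟨A, hA, hA0⟩ := IsRadialSolution.exists_amplitude ⟨hv, hw⟩ hm hc hα hαβ.le hb3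
    have hne : A α ≠ 0 := fun h0 => hvr (by rw [(hA r hr).1, hA0 h0 r hr, zero_mul])
    rw [(hA α hmem).1, (hA α hmem).2] at hb1
    rw [(hA α hmem).1] at hb2
    exact (mul_eq_zero.1 ((boundary_condition_iff h _ _).1 ⟨hb1, hb2⟩)).resolve_left hne
  · intro hs
    obtain ⟨ρ, hρ, hv, hw⟩ := exists_isRadialSolution hm hc hα hαβ.le t
    obtain ⟨hb1, hb2⟩ := (boundary_condition_iff h (ρ α) _).2 (by rw [hs, mul_zero])
    refine ⟨_, _, hv, hw, hb1, hb2, ?_, β, right_mem_Icc.2 hαβ.le, ?_⟩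
    · simp only [phase_right hm hc hα hαβ.le, sin_zero, mul_zero]
    · simp only [phase_right hm hc hα hαβ.le, cos_zero, mul_one]
      exact (hρ β).ne'

theorem isNthEigenvalue_one {N : ℕ} (hN : 2 ≤ N) {α β : ℝ} (hα : 0 < α) (hαβ : α < β)
    {h : WithTop ℝ} {l : ℕ} {t : ℝ}
    (ht : endPhase ((N : ℝ) - 1) ((l : ℝ) * ((l : ℝ) + N - 2)) α β t = bcAngle h) :
    IsNthEigenvalue N α β h l 1 t := by
  have hN' : (2 : ℝ) ≤ N := by exact_mod_cast hN
  have hl : (0 : ℝ) ≤ l := Nat.cast_nonneg l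
  have hmono := strictMono_endPhase (m := (N : ℝ) - 1) (c := (l : ℝ) * ((l : ℝ) + N - 2))
    (by linarith) (mul_nonneg hl (by linarith)) hα hαβ
  have hmem : t ∈ radialSpectrum N α β h l :=
    (mem_radialSpectrum_iff hN hα hαβ h l t).2 ⟨0, by simpa using ht⟩
  refine ⟨hmem, ?_⟩
  have hset : radialSpectrum N α β h l ∩ Iic t = {t} := by
    refine Subset.antisymm ?_ (singleton_subset_iff.2 ⟨hmem, le_refl t⟩)
    rintro s ⟨hs, hst⟩
    obtain ⟨n, hn⟩ := (mem_radialSpectrum_iff hN hα hαβ h l s).1 hs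
    have h1 := hmono.monotone hst
    have h2 : (0 : ℝ) ≤ n * π := by positivity
    exact hmono.injective (by linarith)
  rw [hset, encard_singleton]
  rfl

theorem isNthEigenvalue_two {N : ℕ} (hN : 2 ≤ N) {α β : ℝ} (hα : 0 < α) (hαβ : α < β)
    {h : WithTop ℝ} {l : ℕ} {t : ℝ}
    (ht : endPhase ((N : ℝ) - 1) ((l : ℝ) * ((l : ℝ) + N - 2)) α β t = bcAngle h + π) :
    IsNthEigenvalue N α β h l 2 t := by
  have hN' : (2 : ℝ) ≤ N := by exact_mod_cast hN
  have hl : (0 : ℝ) ≤ l := Nat.cast_nonneg l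
  have hm : 0 ≤ (N : ℝ) - 1 := by linarith
  have hc : 0 ≤ (l : ℝ) * ((l : ℝ) + N - 2) := mul_nonneg hl (by linarith)
  have hmono := strictMono_endPhase hm hc hα hαβ
  have hmem : t ∈ radialSpectrum N α β h l :=
    (mem_radialSpectrum_iff hN hα hαβ h l t).2 ⟨1, by simpa using ht⟩
  obtain ⟨s, hs⟩ := exists_endPhase_eq hm hc hα hαβ (neg_pi_div_two_lt_bcAngle h)
    ((bcAngle_le_pi_div_two h).trans (by linarith [pi_pos]))
  have hsmem : s ∈ radialSpectrum N α β h l :=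
    (mem_radialSpectrum_iff hN hα hαβ h l s).2 ⟨0, by simpa using hs⟩
  have hst : s < t := hmono.lt_iff_lt.1 (by linarith [pi_pos])
  refine ⟨hmem, ?_⟩
  have hset : radialSpectrum N α β h l ∩ Iic t = {s, t} := by
    refine Subset.antisymm ?_ ?_
    · rintro x ⟨hx, hxt⟩
      obtain ⟨n, hn⟩ := (mem_radialSpectrum_iff hN hα hαβ h l x).1 hx
      have h1 := hmono.monotone hxt
      have h2 : (n : ℝ) ≤ 1 := by
        refine le_of_mul_le_mul_right ?_ pi_pos
        linarith
      have h3 : n ≤ 1 := by exact_mod_cast h2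
      interval_cases n
      · exact Or.inl (hmono.injective (by push_cast at hn; linarith))
      · exact Or.inr (hmono.injective (by push_cast at hn; linarith))
    · rintro x (rfl | rfl)
      · exact ⟨hsmem, hst.le⟩
      · exact ⟨hmem, self_mem_Iic⟩
  rw [hset, encard_pair hst.ne]
  rfl

/-- The eigenvalue chain in terms of end point phases. -/
theorem eigenvalueChain_of_phase {N : ℕ} (hN : 2 ≤ N) {α β : ℝ} (hα : 0 < α) (hαβ : α < β)
    {h : WithTop ℝ} {l : ℕ}
    (H : ∀ t, endPhase ((N : ℝ) - 1) 0 α β t = bcAngle h + π →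
      bcAngle h < endPhase ((N : ℝ) - 1) ((l : ℝ) * ((l : ℝ) + N - 2)) α β t) :
    EigenvalueChain N α β h l := by
  have hN' : (2 : ℝ) ≤ N := by exact_mod_cast hN
  have hm : 0 ≤ (N : ℝ) - 1 := by linarith
  have hc : ∀ k : ℕ, 0 ≤ (k : ℝ) * ((k : ℝ) + N - 2) := fun k => by
    have hk : (0 : ℝ) ≤ k := Nat.cast_nonneg k
    exact mul_nonneg hk (by linarith)
  have hlo := neg_pi_div_two_lt_bcAngle h
  have hhi := bcAngle_le_pi_div_two h
  choose s hs using fun k : ℕ => exists_endPhase_eq hm (hc k) hα hαβ hlo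
    (hhi.trans (by linarith [pi_pos]))
  obtain ⟨T, hT⟩ := exists_endPhase_eq hm (hc 0) hα hαβ (η := bcAngle h + π)
    (by linarith [pi_pos]) (by linarith)
  have h1 : ∀ k, IsNthEigenvalue N α β h k 1 (s k) := fun k => isNthEigenvalue_one hN hα hαβ (hs k)
  have h2 : IsNthEigenvalue N α β h 0 2 T := isNthEigenvalue_two hN hα hαβ hT
  have h1' : ∀ k, tau N α β h k 1 = s k := fun k => by
    have := (h1 k).tau_eq
    exact_mod_cast this
  have h2' : tau N α β h 0 2 = T := by
    have := h2.tau_eq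
    exact_mod_cast this
  refine ⟨fun k _ => by rw [h1']; exact h1 k, by rw [h2']; exact h2, fun k _ => ?_, ?_⟩
  · rw [h1', h1']
    refine (strictMono_endPhase hm (hc (k + 1)) hα hαβ).lt_iff_lt.1 ?_
    rw [hs (k + 1), ← hs k]
    refine endPhase_lt_of_lt hm (hc k) ?_ hα hαβ _
    have hk : (0 : ℝ) ≤ k := Nat.cast_nonneg k
    push_cast
    linarith
  · rw [h1', h2']
    refine (strictMono_endPhase hm (hc l) hα hαβ).lt_iff_lt.1 ?_
    rw [hs l]
    exact H T (by simpa using hT)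

theorem angular_coeff_nonneg {N : ℕ} (hN : 2 ≤ N) (l : ℕ) :
    0 ≤ (l : ℝ) * ((l : ℝ) + N - 2) := by
  have hN' : (2 : ℝ) ≤ N := by exact_mod_cast hN
  have hl : (0 : ℝ) ≤ l := Nat.cast_nonneg l
  exact mul_nonneg hl (by linarith)

theorem dimension_coeff_nonneg {N : ℕ} (hN : 2 ≤ N) : 0 ≤ (N : ℝ) - 1 := by
  have hN' : (2 : ℝ) ≤ N := by exact_mod_cast hN
  linarith

/-! ### Boundary parameters near `-∞`, and thin annuli -/

theorem exists_forall_le_eigenvalueChain {N : ℕ} (hN : 2 ≤ N) {α β : ℝ} (hα : 0 < α)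
    (hαβ : α < β) (l : ℕ) :
    ∃ x : ℝ, ∀ h : WithTop ℝ, h ≤ (x : WithTop ℝ) → EigenvalueChain N α β h l := by
  have hm := dimension_coeff_nonneg hN
  have hc := angular_coeff_nonneg hN l
  obtain ⟨d, hd⟩ := exists_endPhase_eq hm le_rfl hα hαβ (η := π / 2) (by linarith [pi_pos])
    (by linarith [pi_pos])
  set e := endPhase ((N : ℝ) - 1) ((l : ℝ) * ((l : ℝ) + N - 2)) α β d
  have he : -(π / 2) < e := neg_pi_div_two_lt_endPhase hm hc hα hαβ.le d
  -- The cap at `0` keeps the angle in the range where `arctan` inverts `tan`.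
  refine ⟨tan (min e 0), fun h hh => eigenvalueChain_of_phase hN hα hαβ fun t ht => ?_⟩
  have h1 := monotone_bcAngle hh
  rw [bcAngle_coe, arctan_tan (lt_min he (by linarith [pi_pos]))
    ((min_le_right _ _).trans_lt (by linarith [pi_pos]))] at h1
  have h2 : d < t := (strictMono_endPhase hm le_rfl hα hαβ).lt_iff_lt.1 (by
    rw [hd, ht]; linarith [neg_pi_div_two_lt_bcAngle h])
  exact (h1.trans (min_le_left _ _)).trans_lt (strictMono_endPhase hm hc hα hαβ h2)

theorem eigenvalueChain_of_thin {N : ℕ} (hN : 2 ≤ N) {α β : ℝ} (hα : 0 < α)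
    (hαβ : α < β) {l : ℕ} (h₁ : ((N : ℝ) - 1) * ((β - α) / α) ≤ 1 / 4)
    (h₂ : (l : ℝ) * ((l : ℝ) + N - 2) * ((β - α) / α) ^ 2 ≤ 1 / 4) (h : WithTop ℝ) :
    EigenvalueChain N α β h l := by
  have hm := dimension_coeff_nonneg hN
  have hc := angular_coeff_nonneg hN l
  refine eigenvalueChain_of_phase hN hα hαβ fun t ht => ?_
  set m := (N : ℝ) - 1
  set c := (l : ℝ) * ((l : ℝ) + N - 2)
  have hδ : 0 < β - α := sub_pos.2 hαβ
  set δ := β - α with hδd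
  have hπ := pi_gt_three
  have em : m / α = m * (δ / α) / δ := by field_simp
  have ec : c / α ^ 2 = c * (δ / α) ^ 2 / δ ^ 2 := by field_simp
  have hmono := strictMono_endPhase hm hc hα hαβ
  have hmono0 := strictMono_endPhase hm le_rfl hα hαβ
  have hlower : ∀ x y : ℝ, 0 < x → y * x + 1 / 4 * x + 1 / 4 ≤ x ^ 2 →
      rescale (x / δ) y ≤ endPhase m c α β ((x / δ) ^ 2) := fun x y hx hxy => by
    have := rescale_le_endPhase (k := y / δ) hm hc hα hαβ (div_pos hx hδ) (by
      rw [em, ec]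
      have e1 : (x / δ) ^ 2 - m * (δ / α) / δ * (x / δ) - c * (δ / α) ^ 2 / δ ^ 2 =
        (x ^ 2 - m * (δ / α) * x - c * (δ / α) ^ 2) / δ ^ 2 := by field_simp
      have e2 : y / δ * (x / δ) = y * x / δ ^ 2 := by field_simp
      rw [e1, e2]
      have e3 := mul_le_mul_of_nonneg_right h₁ hx.le
      gcongr
      linarith)
    rwa [← hδd, div_mul_cancel₀ _ hδ.ne'] at this
  have hupper : ∀ x y : ℝ, 0 < x → x + 1 / 4 ≤ y →
      endPhase m 0 α β ((x / δ) ^ 2) ≤ rescale (x / δ) y := fun x y hx hxy => by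
    have := endPhase_le_rescale (k := y / δ) hm le_rfl hα hαβ (div_pos hx hδ) (by
      rw [em, ← add_div]
      gcongr
      linarith)
    rwa [← hδd, div_mul_cancel₀ _ hδ.ne'] at this
  -- A single test value `√t δ` separates the phases. At `π/4` the radial one is at most `π/2 < η +
  -- π` and the other at least `0`; at `3π/4` the bounds are `π` and `π/2`.
  rcases le_or_gt (bcAngle h) 0 with hη | hη
  · have h3 := hlower (π / 4) 0 (by positivity) (by nlinarith)
    have h4 := hupper (π / 4) (π / 2) (by positivity) (by linarith)
    rw [rescale_eq_self (by simp)] at h3 h4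
    have h5 : (π / 4 / δ) ^ 2 < t := hmono0.lt_iff_lt.1 (by
      rw [ht]; linarith [neg_pi_div_two_lt_bcAngle h])
    exact hη.trans_lt (h3.trans_lt (hmono h5))
  · have h3 := hlower (3 * π / 4) (π / 2) (by positivity) (by nlinarith)
    have h4 := hupper (3 * π / 4) π (by positivity) (by linarith)
    rw [rescale_eq_self (by simp)] at h3 h4
    have h5 : (3 * π / 4 / δ) ^ 2 < t := hmono0.lt_iff_lt.1 (by
      rw [ht]; linarith)
    exact (bcAngle_le_pi_div_two h).trans_lt (h3.trans_lt (hmono h5))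

theorem exists_forall_ge_eigenvalueChain {N : ℕ} (hN : 2 ≤ N) {β : ℝ} (hβ : 0 < β) (l : ℕ) :
    ∃ αstar ∈ Ioo 0 β, ∀ α ∈ Ico αstar β, ∀ h : WithTop ℝ, EigenvalueChain N α β h l := by
  have hm := dimension_coeff_nonneg hN
  have hc := angular_coeff_nonneg hN l
  set m := (N : ℝ) - 1 with hmd
  set c := (l : ℝ) * ((l : ℝ) + N - 2) with hcd
  set K := 1 + 4 * m + 4 * c with hK
  have hK1 : 1 ≤ K := by linarith
  have hK0 : 0 < K := by linarith
  have hpos : 0 < β / (1 + K) := by positivity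
  -- At this radius `(β - α) / α` is exactly `1 / K`, and it decreases as `α` grows.
  refine ⟨β - β / (1 + K), ⟨?_, by linarith⟩, fun α hα h => ?_⟩
  · rw [sub_pos]
    exact div_lt_self hβ (by linarith)
  · have hα0 : 0 < α := lt_of_lt_of_le (sub_pos.2 (div_lt_self hβ (by linarith))) hα.1
    have hx : (β - α) / α ≤ 1 / K := by
      rw [div_le_div_iff₀ hα0 hK0]
      have h1 : β - β / (1 + K) = β * K / (1 + K) := by field_simp; ring
      have h2 := hα.1
      rw [h1, div_le_iff₀ (by linarith)] at h2
      linarith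
    have hx0 : 0 ≤ (β - α) / α := div_nonneg (sub_nonneg.2 hα.2.le) hα0.le
    have hKle : ∀ y, 0 ≤ y → 4 * y ≤ K → y * ((β - α) / α) ≤ 1 / 4 := fun y hy hyK => by
      refine (mul_le_mul_of_nonneg_left hx hy).trans ?_
      rw [mul_one_div, div_le_div_iff₀ hK0 (by norm_num)]
      linarith
    refine eigenvalueChain_of_thin hN hα0 hα.2 (hKle _ hm (by linarith)) ?_ h
    refine le_trans ?_ (hKle c hc (by linarith))
    refine mul_le_mul_of_nonneg_left (pow_le_of_le_one hx0 ?_ two_ne_zero) hc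
    exact hx.trans ((div_le_one hK0).2 hK1)

/-! ### The case `l = 2` through the Hessian -/

/-- If `v` solves the equation with `c = 0`, then its second radial derivative minus `v' / r`
solves the equation with `c = 2 (m + 1)`. -/
theorem IsRadialSolution.hessian {m a b t : ℝ} {v w : ℝ → ℝ} (ha : 0 < a)
    (h : IsRadialSolution m 0 a b t v w) :
    IsRadialSolution m (2 * (m + 1)) a b t (fun r => -((m + 1) / r) * w r - t * v r)
      (fun r => ((m + 1) ^ 2 / r ^ 2 - t) * w r + (m + 1) * t / r * v r) := by
  refine ⟨fun r hr => ?_, fun r hr => ?_⟩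
  all_goals
    have hr0 : r ≠ 0 := (ha.trans_le hr.1).ne'
    have hv := h.1 r hr
    have hw := h.2 r hr
    have hinv := (hasDerivAt_inv hr0).hasDerivWithinAt (s := Icc a b)
  · have := ((hinv.const_mul (-(m + 1))).mul hw).sub (hv.const_mul t)
    refine (this.congr_of_mem (fun x _ => ?_) hr).congr_deriv ?_
    · simp only [Pi.sub_apply, Pi.mul_apply]; ring
    · field_simp; ring
  · have := ((((hinv.pow 2).const_mul ((m + 1) ^ 2)).sub_const t).mul hw).add
      ((hinv.const_mul ((m + 1) * t)).mul hv)
    refine (this.congr_of_mem (fun x _ => ?_) hr).congr_deriv ?_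
    · simp only [Pi.add_apply, Pi.mul_apply, Pi.pow_apply]; ring
    · simp only [Pi.pow_apply, Nat.add_one_sub_one, pow_one]; field_simp; ring

/-- Sturm comparison with a positive solution: the logarithmic derivative at `b` decides. -/
theorem IsRadialSolution.neg_of_pos {m c a b t : ℝ} {V U ψ χ : ℝ → ℝ} (ha : 0 < a)
    (hV : IsRadialSolution m c a b t V U) (hψ : IsRadialSolution m c a b t ψ χ)
    (hpos : ∀ r ∈ Ioc a b, 0 < V r) (hU : U b = 0) (hψb : ψ b < 0) (hχb : 0 < χ b) :
    ∀ r ∈ Ioc a b, ψ r < 0 := by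
  intro r₁ hr₁
  have hab : a < b := hr₁.1.trans_le hr₁.2
  have hr0 : ∀ r ∈ Icc a b, r ≠ 0 := fun r hr => (ha.trans_le hr.1).ne'
  -- The Wronskian keeps its sign from `b`, so `ψ / V` is increasing wherever `V > 0`; it is
  -- negative at `b`, hence before.
  have hF : ∀ r ∈ Icc a b, 0 < χ r * V r - ψ r * U r := by
    obtain ⟨E, hE, hA⟩ := exists_antitoneOn_mul hab.le
      (κ := fun r => -(m / r)) (D := fun r => χ r * V r - ψ r * U r)
      (continuousOn_const.div continuousOn_id hr0).neg
      (fun r hr => ((hψ.2 r hr).mul (hV.1 r hr)).sub ((hψ.1 r hr).mul (hV.2 r hr)))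
      (fun r hr => le_of_eq (by ring))
    intro r hr
    have h1 := hA hr (right_mem_Icc.2 hab.le) hr.2
    have h2 : 0 < (χ b * V b - ψ b * U b) * E b := by
      rw [hU, mul_zero, sub_zero]
      exact mul_pos (mul_pos hχb (hpos b (right_mem_Ioc.2 hab))) (hE b)
    exact pos_of_mul_pos_left (h2.trans_le h1) (hE r).le
  have hsub : Icc r₁ b ⊆ Icc a b := Icc_subset_Icc_left hr₁.1.le
  have hV0 : ∀ r ∈ Icc r₁ b, 0 < V r := fun r hr => hpos r ⟨hr₁.1.trans_le hr.1, hr.2⟩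
  obtain ⟨E, hE, hA⟩ := exists_antitoneOn_mul hr₁.2 (κ := fun r => U r / V r)
    (D := fun r => -ψ r) (D' := fun r => -χ r)
    (ContinuousOn.div (fun r hr => (hV.2 r (hsub hr)).continuousWithinAt.mono hsub)
      (fun r hr => (hV.1 r (hsub hr)).continuousWithinAt.mono hsub) fun r hr => (hV0 r hr).ne')
    (fun r hr => ((hψ.1 r (hsub hr)).mono hsub).neg) (fun r hr => by
      rw [div_mul_eq_mul_div, le_div_iff₀ (hV0 r hr)]
      linarith [hF r (hsub hr)])
  have h1 := hA (left_mem_Icc.2 hr₁.2) (right_mem_Icc.2 hr₁.2) hr₁.2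
  have h2 : 0 < -ψ b * E b := mul_pos (neg_pos.2 hψb) (hE b)
  exact neg_pos.1 (pos_of_mul_pos_left (h2.trans_le h1) (hE r₁).le)

theorem endPhase_zero_nonpos {m a b : ℝ} (hm : 0 ≤ m) (ha : 0 < a) (hab : a ≤ b) :
    endPhase m 0 a b 0 ≤ 0 :=
  le_of_slope_le (m := m) (c := 0) (t := 0) ha hab
    (fun r _ => hasDerivWithinAt_const r (Icc a b) (0 : ℝ))
    (hasDerivWithinAt_phase hm le_rfl ha hab 0) (fun r _ => by simp [slope])
    (phase_right hm le_rfl ha hab 0).le a (left_mem_Icc.2 hab)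

theorem pi_div_two_lt_endPhase_of_eq_pi {m a b t : ℝ} (hm : 0 ≤ m) (ha : 0 < a) (hab : a < b)
    (ht : endPhase m 0 a b t = π) : π / 2 < endPhase m (2 * (m + 1)) a b t := by
  by_contra! hle
  have hc : 0 ≤ 2 * (m + 1) := by linarith
  have ht0 : 0 < t := (strictMono_endPhase hm le_rfl ha hab).lt_iff_lt.1
    ((endPhase_zero_nonpos hm ha hab.le).trans_lt (ht ▸ pi_pos))
  have hb : 0 < b := ha.trans hab
  obtain ⟨ρ, hρ, hv⟩ := exists_isRadialSolution hm le_rfl ha hab.le t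
  obtain ⟨ρ', hρ', hV⟩ := exists_isRadialSolution hm hc ha hab.le t
  have hψ := hv.hessian ha
  have hθb := phase_right hm le_rfl ha hab.le t
  have hθb' := phase_right hm hc ha hab.le t
  rw [endPhase] at ht
  have hneg := IsRadialSolution.neg_of_pos ha hV hψ
    (fun r hr => mul_pos (hρ' r) (cos_pos_of_mem_Ioo
      ⟨neg_pi_div_two_lt_phase hm hc ha hab.le t (Ioc_subset_Icc_self hr),
        phase_lt_pi_div_two hm hc ha hab.le hle hr⟩))
    (by simp only [hθb', sin_zero, mul_zero])
    (by simp only [hθb, sin_zero, cos_zero, mul_zero, mul_one]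
        linarith [mul_pos ht0 (hρ b)])
    (by simp only [hθb, sin_zero, cos_zero, mul_zero, mul_one, zero_add]
        have := hρ b
        positivity)
  -- `V` may vanish at `a`, so negativity only gives `ψ(a) ≤ 0` in the limit. But phase `π` at `a`
  -- means `v(a) < 0 = v'(a)`, so `ψ(a) = -t v(a) > 0`.
  have hle := le_on_closure (fun r hr => (hneg r hr).le)
    (by rw [closure_Ioc hab.ne]; exact fun r hr => (hψ.1 r hr).continuousWithinAt)
    continuousOn_const (x := a) (by rw [closure_Ioc hab.ne]; exact left_mem_Icc.2 hab.le)
  simp only [ht, sin_pi, cos_pi, mul_zero, mul_neg, mul_one] at hle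
  linarith [mul_pos ht0 (hρ a)]

theorem exists_neg_forall_ge_eigenvalueChain {N : ℕ} (hN : 2 ≤ N) {α β : ℝ} (hα : 0 < α)
    (hαβ : α < β) : ∃ x : ℝ, x < 0 ∧
      ∀ h : WithTop ℝ, (x : WithTop ℝ) ≤ h → EigenvalueChain N α β h 2 := by
  have hm := dimension_coeff_nonneg hN
  have hc := angular_coeff_nonneg hN 2
  have hπ := pi_pos
  have hmono := strictMono_endPhase hm hc hα hαβ
  have hmono0 := strictMono_endPhase hm le_rfl hα hαβ
  obtain ⟨d, hd⟩ := exists_endPhase_eq hm hc hα hαβ (η := π / 2) (by linarith) (by linarith)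
  obtain ⟨T, hT⟩ := exists_endPhase_eq hm le_rfl hα hαβ (η := π) (by linarith) (by linarith)
  have hTd : d < T := hmono.lt_iff_lt.1 (by
    have h1 := pi_div_two_lt_endPhase_of_eq_pi hm hα hαβ hT
    have h2 : 2 * ((N : ℝ) - 1 + 1) = ((2 : ℕ) : ℝ) * (((2 : ℕ) : ℝ) + N - 2) := by
      push_cast; ring
    rwa [h2, ← hd] at h1)
  have hlt := hmono0 hTd
  rw [hT] at hlt
  set e := max (endPhase ((N : ℝ) - 1) 0 α β d - π) (-π / 4) with he
  have he0 : e < 0 := max_lt (by linarith) (by linarith)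
  have he1 : -π / 4 ≤ e := le_max_right _ _
  have he2 : endPhase ((N : ℝ) - 1) 0 α β d - π ≤ e := le_max_left _ _
  -- Halving the negative `e` gives `η ≥ e / 2 > e`, so the radial phase at `d` is strictly below `η
  -- + π`.
  refine ⟨tan (e / 2), tan_neg_of_neg_of_pi_div_two_lt (by linarith) (by linarith),
    fun h hh => eigenvalueChain_of_phase hN hα hαβ fun t ht => ?_⟩
  have h1 := monotone_bcAngle hh
  rw [bcAngle_coe, arctan_tan (by linarith) (by linarith)] at h1
  have h2 : d < t := hmono0.lt_iff_lt.1 (by rw [ht]; linarith)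
  exact (bcAngle_le_pi_div_two h).trans_lt (hd ▸ hmono h2)

end RadialPhase

/-! ### Assembling the threshold function -/

theorem lemma2p3 (N : ℕ) (hN : 2 ≤ N) (β : ℝ) (hβ : 0 < β) (l : ℕ) (hl : 1 ≤ l) :
    ∃ hbar : ℝ → WithTop ℝ,
      (∀ α ∈ Set.Ioo 0 β, ∀ h : WithTop ℝ, h ≤ hbar α → EigenvalueChain N α β h l) ∧
      (∃ αstar ∈ Set.Ioo 0 β, ∀ α ∈ Set.Ico αstar β, hbar α = ⊤) ∧
      (l = 2 → ∀ α ∈ Set.Ioo 0 β, ∃ hstar : ℝ, hstar < 0 ∧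
        ∀ h : WithTop ℝ, (h ≤ hbar α ∨ (hstar : WithTop ℝ) ≤ h) →
          EigenvalueChain N α β h 2) := by
  classical
  obtain ⟨αstar, hstar, hthin⟩ := RadialPhase.exists_forall_ge_eigenvalueChain hN hβ l
  have hex : ∀ α : ℝ, ∃ x : ℝ, α ∈ Ioo 0 β →
      ∀ h : WithTop ℝ, h ≤ (x : WithTop ℝ) → EigenvalueChain N α β h l := fun α => by
    by_cases hα : α ∈ Ioo 0 β
    · obtain ⟨x, hx⟩ := RadialPhase.exists_forall_le_eigenvalueChain hN hα.1 hα.2 l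
      exact ⟨x, fun _ => hx⟩
    -- An arbitrary value outside `(0, β)`, so that the choice is defined on all of `ℝ`.
    · exact ⟨0, fun h => absurd h hα⟩
  choose x hx using hex
  have hmain : ∀ α ∈ Ioo 0 β, ∀ h : WithTop ℝ,
      h ≤ (if α ∈ Ico αstar β then ⊤ else (x α : WithTop ℝ)) → EigenvalueChain N α β h l := by
    intro α hα h hh
    by_cases hmem : α ∈ Ico αstar β
    · exact hthin α hmem h
    · rw [if_neg hmem] at hh
      exact hx α hα h hh
  refine ⟨fun α => if α ∈ Ico αstar β then ⊤ else (x α : WithTop ℝ), hmain,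
    ⟨αstar, hstar, fun α hα => if_pos hα⟩, ?_⟩
  rintro rfl α hα
  obtain ⟨y, hy, hchain⟩ := RadialPhase.exists_neg_forall_ge_eigenvalueChain hN hα.1 hα.2
  exact ⟨y, hy, fun h hh => hh.elim (hmain α hα h) (hchain h)⟩
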